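/- Let $\nu\ge 0$. For $k\in\mathbb N_0$ put $$\gamma_\nu(2k)=\frac{2^{2k}k!\,\Gamma(k+\nu+1/2)}{\Gamma(\nu+1/2)},\qquad \gamma_\nu(2k+1)=\frac{2^{2k+1}k!\,\Gamma(k+\nu+3/2)}{\Gamma(\nu+1/2)},\qquad e_\nu(x)=\sum_{r=0}^\infty \frac{x^r}{\gamma_\nu(r)},$$ and for $n\in\mathbb N$, $x\ge 0$ let $$T_n(g;x)=\frac{n-1}{e_\nu(nx)}\sum_{r=1}^\infty\binom{n+r-2}{r-1}\frac{(nx)^r}{\gamma_\nu(r)}\int_0^\infty s^{r-1}(1+s)^{-n-r+1}g(s)\,ds+\frac{g(0)}{e_\nu(nx)}.$$ Let $C^*_\rho(\mathbb R^+)$ be the space of continuous functions $g:[0,\infty)\to\mathbb R$ such that $|g(x)|\le M_g(1+x^2)$ for all $x\ge 0$, with a constant $M_g$ depending on $g$, and $\lim_{x\to\infty} g(x)/(1+x^2)$ exists and is finite. For $\delta>0$ let $$\Omega(g;\delta)=\sup_{x\ge 0,\ x+h\ge 0,\ |h|\le\delta}\frac{|g(x+h)-g(x)|}{(1+h^2)(1+x^2)}.$$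 **Theorem 10.** There is a constant $M_\nu>0$, depending only on $\nu$, such that for every integer $n\ge 5$ and every $g\in C^*_\rho(\mathbb R^+)$ the integrals and series defining $T_n(g;x)$ converge for all $x\ge 0$, and $$\sup_{x\in[0,\infty)}\frac{|T_n(g;x)-g(x)|}{(1+x^2)^3}\le M_\nu\Bigl(1+\frac1n\Bigr)\Omega\Bigl(g;\frac1{\sqrt n}\Bigr).$$ -/

import Mathlib

open scoped Nat
open Filter Topology

noncomputable section

/-- The coefficients `γ_ν(r)`:
`γ_ν(2k) = 2^(2k) k! Γ(k+ν+1/2) / Γ(ν+1/2)` and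
`γ_ν(2k+1) = 2^(2k+1) k! Γ(k+ν+3/2) / Γ(ν+1/2)`; here `k = r / 2`. -/
def dunklGamma (ν : ℝ) (r : ℕ) : ℝ :=
  if Even r then
    2 ^ r * ((r / 2)! : ℝ) * Real.Gamma (((r / 2 : ℕ) : ℝ) + ν + 1 / 2) / Real.Gamma (ν + 1 / 2)
  else
    2 ^ r * ((r / 2)! : ℝ) * Real.Gamma (((r / 2 : ℕ) : ℝ) + ν + 3 / 2) / Real.Gamma (ν + 1 / 2)

/-- The Dunkl exponential `e_ν(x) = ∑_{r ≥ 0} x^r / γ_ν(r)`. -/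
def dunklExp (ν x : ℝ) : ℝ := ∑' r : ℕ, x ^ r / dunklGamma ν r

/-- The integrand `s^(r-1) (1+s)^(-n-r+1) g(s)`, used for `n, r ≥ 1`. -/
def betaIntegrand (n r : ℕ) (g : ℝ → ℝ) (s : ℝ) : ℝ :=
  s ^ (r - 1) / (1 + s) ^ (n + r - 1) * g s

/-- The `r`-th term (`r ≥ 1`) of the series that defines the operator `T_n`. -/
def szaszBetaTerm (ν : ℝ) (n : ℕ) (g : ℝ → ℝ) (x : ℝ) (r : ℕ) : ℝ :=
  ((n + r - 2).choose (r - 1) : ℝ) * (((n : ℝ) * x) ^ r / dunklGamma ν r) *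
    ∫ s in Set.Ioi (0 : ℝ), betaIntegrand n r g s

/-- The Dunkl analogue `T_n(g; x)` of the Szász beta type operators; the series runs over
`r = k + 1 ≥ 1`. -/
def szaszBeta (ν : ℝ) (n : ℕ) (g : ℝ → ℝ) (x : ℝ) : ℝ :=
  ((n : ℝ) - 1) / dunklExp ν (n * x) * (∑' k : ℕ, szaszBetaTerm ν n g x (k + 1)) +
    g 0 / dunklExp ν (n * x)

/-- `T_n(g; x)` is meaningful: every integral in it exists and is finite, and both series in it
converge. -/
def SzaszBetaDefined (ν : ℝ) (n : ℕ) (g : ℝ → ℝ) (x : ℝ) : Prop :=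
  (∀ r : ℕ, 1 ≤ r → MeasureTheory.IntegrableOn (betaIntegrand n r g) (Set.Ioi (0 : ℝ))) ∧
  (Summable fun r : ℕ => ((n : ℝ) * x) ^ r / dunklGamma ν r) ∧
  Summable fun k : ℕ => szaszBetaTerm ν n g x (k + 1)

/-- The weight `ρ(x) = 1 + x^2`. -/
def rhoWeight (x : ℝ) : ℝ := 1 + x ^ 2

/-- The space `C*_ρ(ℝ⁺)` of functions that are continuous on `[0,∞)`, bounded there by a multiple
of `ρ`, and for which `g / ρ` has a finite limit at infinity. Only the values on `[0,∞)` matter. -/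
def CRhoStar : Set (ℝ → ℝ) :=
  {g | ContinuousOn g (Set.Ici 0) ∧
    (∃ M : ℝ, ∀ x : ℝ, 0 ≤ x → |g x| ≤ M * rhoWeight x) ∧
    ∃ c : ℝ, Tendsto (fun x => g x / rhoWeight x) atTop (𝓝 c)}

/-- The quotients whose supremum is the weighted modulus of continuity: `x ≥ 0`, `|h| ≤ δ`, and
`x + h` in the domain `[0,∞)` of `g`. -/
def weightedQuotients (g : ℝ → ℝ) (δ : ℝ) : Set ℝ :=
  {q | ∃ x h : ℝ, 0 ≤ x ∧ 0 ≤ x + h ∧ |h| ≤ δ ∧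
    q = |g (x + h) - g x| / ((1 + h ^ 2) * (1 + x ^ 2))}

/-- The weighted modulus of continuity `Ω(g; δ)`. -/
def weightedModulus (g : ℝ → ℝ) (δ : ℝ) : ℝ := sSup (weightedQuotients g δ)

/-- On `C*_ρ` the supremum in `Ω(g; δ)` is finite. -/
theorem weightedQuotients_bddAbove {g : ℝ → ℝ} (hg : g ∈ CRhoStar) (δ : ℝ) :
    BddAbove (weightedQuotients g δ) := by
  obtain ⟨-, ⟨M, hM⟩, -⟩ := hg
  have hM0 : 0 ≤ M := by
    have h := (abs_nonneg _).trans (hM 0 le_rfl)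
    simpa [rhoWeight] using h
  refine ⟨3 * M, ?_⟩
  rintro q ⟨x, h, hx, hxh, -, rfl⟩
  have h1 := hM x hx
  have h2 := hM (x + h) hxh
  have h3 := abs_sub (g (x + h)) (g x)
  have hpos : 0 < (1 + h ^ 2) * (1 + x ^ 2) := by positivity
  rw [div_le_iff₀ hpos]
  unfold rhoWeight at h1 h2
  have key : (1 + (x + h) ^ 2) + (1 + x ^ 2) ≤ 3 * ((1 + h ^ 2) * (1 + x ^ 2)) := by
    nlinarith [sq_nonneg (x - h), sq_nonneg (x * h), sq_nonneg x, sq_nonneg h]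
  nlinarith [mul_le_mul_of_nonneg_left key hM0]

end

open MeasureTheory Set

/-! ### The coefficients `γ_ν` and the Dunkl weights -/

/-! `T_n(g; x)` is the mean of `g` under a probability law on `[0,∞)`: an index `r` is drawn with
weight `(nx)^r / γ_ν(r)`, normalised by `e_ν(nx)`, and then `t` is `0` if `r = 0` and beta-prime
distributed otherwise. So it suffices to average a pointwise bound of `|g t - g x|`.

Chaining steps of length at most `1/√n` (`abs_sub_le_of_weightedModulus`) bounds the increment by
`Ω`; `abs_sub_le_cubic` then removes the absolute values of `t - x`, leaving a constant plus `n
(t-x)² (1+t+x)`. This majorant is only cubic in `t`, so three beta moments suffice, and `n ≥ 5`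
makes them finite.

It remains to see that the mean of `(t-x)² (1+t+x)` is `O((1+x²)²/n)`. Given `r`, the beta moments
are explicit (`abs_betaMean_sub_le`). The sum over `r` uses the parity-corrected index `dunklShift`,
whose first moment is exact and whose next two are bounded above (`dunklShift_moments`);
`mean_cubic_le_shift` passes to that index, and in `cubic_moment_bound_normalized` all terms of
order `n⁰` cancel. -/

/-- The factor `r + 2νθ_r` (`θ_r` the parity of `r`) in the recurrence of `γ_ν`. -/
def dunklShift (ν : ℝ) (r : ℕ) : ℝ := r + if Even r then 0 else 2 * ν

theorem dunklShift_zero (ν : ℝ) : dunklShift ν 0 = 0 := by simp [dunklShift]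

theorem le_dunklShift {ν : ℝ} (hν : 0 ≤ ν) (r : ℕ) : (r : ℝ) ≤ dunklShift ν r := by
  unfold dunklShift; split_ifs <;> linarith

theorem dunklShift_le {ν : ℝ} (hν : 0 ≤ ν) (r : ℕ) : dunklShift ν r ≤ r + 2 * ν := by
  unfold dunklShift; split_ifs <;> linarith

theorem dunklShift_nonneg {ν : ℝ} (hν : 0 ≤ ν) (r : ℕ) : 0 ≤ dunklShift ν r :=
  (Nat.cast_nonneg r).trans (le_dunklShift hν r)

theorem dunklShift_succ_le {ν : ℝ} (hν : 0 ≤ ν) (r : ℕ) :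
    dunklShift ν (r + 1) ≤ dunklShift ν r + (1 + 2 * ν) := by
  have h1 := dunklShift_le hν (r + 1)
  have h2 := le_dunklShift hν r
  push_cast at h1
  linarith

theorem dunklGamma_zero {ν : ℝ} (hν : 0 ≤ ν) : dunklGamma ν 0 = 1 := by
  have h : Real.Gamma (ν + 1 / 2) ≠ 0 := (Real.Gamma_pos_of_pos (by linarith)).ne'
  simp only [dunklGamma, Even.zero, if_true]
  simp only [pow_zero, Nat.zero_div, Nat.factorial_zero, Nat.cast_one, Nat.cast_zero, zero_add,
    one_mul]
  exact div_self h

/-- From even to odd only the Gamma factor advances, giving `2(k + ν + 1/2)`; from odd to even only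
the factorial does, giving `2(k + 1)`. -/
theorem dunklGamma_succ {ν : ℝ} (hν : 0 ≤ ν) (r : ℕ) :
    dunklGamma ν (r + 1) = dunklShift ν (r + 1) * dunklGamma ν r := by
  rcases Nat.even_or_odd' r with ⟨k, rfl | rfl⟩
  · have h1 : ¬ Even (2 * k + 1) := by simp
    have h2 : Even (2 * k) := by simp
    have h3 : (2 * k + 1) / 2 = k := by omega
    have h4 : 2 * k / 2 = k := by omega
    have h5 : (k : ℝ) + ν + 3 / 2 = (k + ν + 1 / 2) + 1 := by ring
    have h6 : (k : ℝ) + ν + 1 / 2 ≠ 0 := by positivity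
    simp only [dunklGamma, dunklShift, h1, h2, if_true, if_false, h3, h4]
    rw [h5, Real.Gamma_add_one h6]
    push_cast
    ring
  · have h1 : Even (2 * k + 1 + 1) := ⟨k + 1, by ring⟩
    have h2 : ¬ Even (2 * k + 1) := by simp
    have h3 : (2 * k + 1 + 1) / 2 = k + 1 := by omega
    have h4 : (2 * k + 1) / 2 = k := by omega
    have h5 : ((k + 1 : ℕ) : ℝ) + ν + 1 / 2 = k + ν + 3 / 2 := by push_cast; ring
    simp only [dunklGamma, dunklShift, h1, h2, if_true, if_false, h3, h4]
    rw [h5, Nat.factorial_succ]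
    push_cast
    ring

theorem factorial_le_dunklGamma {ν : ℝ} (hν : 0 ≤ ν) (r : ℕ) : (r ! : ℝ) ≤ dunklGamma ν r := by
  induction r with
  | zero => simp [dunklGamma_zero hν]
  | succ r ih =>
    rw [dunklGamma_succ hν, Nat.factorial_succ, Nat.cast_mul]
    exact mul_le_mul (le_dunklShift hν _) ih (by positivity) (dunklShift_nonneg hν _)

theorem dunklGamma_pos {ν : ℝ} (hν : 0 ≤ ν) (r : ℕ) : 0 < dunklGamma ν r :=
  (by positivity : (0 : ℝ) < r !).trans_le (factorial_le_dunklGamma hν r)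

theorem summable_dunklExp {ν y : ℝ} (hν : 0 ≤ ν) (hy : 0 ≤ y) :
    Summable fun r : ℕ => y ^ r / dunklGamma ν r := by
  refine Summable.of_nonneg_of_le
    (fun r => div_nonneg (pow_nonneg hy r) (dunklGamma_pos hν r).le) (fun r => ?_)
    (Real.summable_pow_div_factorial y)
  exact div_le_div_of_nonneg_left (pow_nonneg hy r) (by positivity) (factorial_le_dunklGamma hν r)

theorem dunklExp_pos {ν y : ℝ} (hν : 0 ≤ ν) (hy : 0 ≤ y) : 0 < dunklExp ν y := by
  refine (summable_dunklExp hν hy).tsum_pos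
    (fun r => div_nonneg (pow_nonneg hy r) (dunklGamma_pos hν r).le) 0 ?_
  simp [dunklGamma_zero hν]

/-- Shift rule: `∑ a_r f(r) w_r = y ∑ f(r+1) w_r` for `w_r = y^r / γ_ν(r)`, `a_r = r + 2νθ_r`. -/
theorem hasSum_dunklShift_mul {ν y s : ℝ} (hν : 0 ≤ ν) {f : ℕ → ℝ}
    (hf : HasSum (fun r : ℕ => f (r + 1) * (y ^ r / dunklGamma ν r)) s) :
    HasSum (fun r : ℕ => dunklShift ν r * f r * (y ^ r / dunklGamma ν r)) (y * s) := by
  rw [← hasSum_nat_add_iff' 1]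
  simp only [Finset.range_one, Finset.sum_singleton, dunklShift_zero, zero_mul, sub_zero]
  have e : (fun r : ℕ => dunklShift ν (r + 1) * f (r + 1) * (y ^ (r + 1) / dunklGamma ν (r + 1))) =
      fun r : ℕ => y * (f (r + 1) * (y ^ r / dunklGamma ν r)) := by
    funext r
    have h1 := (dunklGamma_pos hν (r + 1)).ne'
    have h2 := (dunklGamma_pos hν r).ne'
    rw [dunklGamma_succ hν] at h1 ⊢
    have h3 := left_ne_zero_of_mul h1
    field_simp
    ring
  rw [e]
  exact hf.mul_left y

/-- The shift rule turns each moment into a lower one of the shifted index. That index exceeds the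
old one by an amount depending on parity, at most `1 + 2ν`, so exactness is lost after the first
moment. -/
theorem dunklShift_moments {ν y : ℝ} (hν : 0 ≤ ν) (hy : 0 ≤ y) :
    HasSum (fun r : ℕ => y ^ r / dunklGamma ν r) (dunklExp ν y) ∧
    HasSum (fun r : ℕ => dunklShift ν r * (y ^ r / dunklGamma ν r)) (y * dunklExp ν y) ∧
    (∃ A₂, HasSum (fun r : ℕ => dunklShift ν r ^ 2 * (y ^ r / dunklGamma ν r)) A₂ ∧
      A₂ ≤ y * (y + (1 + 2 * ν)) * dunklExp ν y) ∧
    ∃ A₃, HasSum (fun r : ℕ => dunklShift ν r ^ 3 * (y ^ r / dunklGamma ν r)) A₃ ∧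
      A₃ ≤ y * (y ^ 2 + 3 * (1 + 2 * ν) * y + (1 + 2 * ν) ^ 2) * dunklExp ν y := by
  set c := 1 + 2 * ν with hc
  have hc0 : 0 ≤ c := by positivity
  have hw : ∀ r : ℕ, 0 ≤ y ^ r / dunklGamma ν r := fun r =>
    div_nonneg (pow_nonneg hy r) (dunklGamma_pos hν r).le
  have h0 : HasSum (fun r : ℕ => y ^ r / dunklGamma ν r) (dunklExp ν y) :=
    (summable_dunklExp hν hy).hasSum
  have h1 : HasSum (fun r : ℕ => dunklShift ν r * (y ^ r / dunklGamma ν r))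
      (y * dunklExp ν y) := by
    simpa using hasSum_dunklShift_mul (f := fun _ => 1) hν (by simpa using h0)
  have step : ∀ r, dunklShift ν (r + 1) ≤ dunklShift ν r + c := dunklShift_succ_le hν
  have h2' : ∀ r : ℕ, dunklShift ν (r + 1) * (y ^ r / dunklGamma ν r) ≤
      dunklShift ν r * (y ^ r / dunklGamma ν r) + c * (y ^ r / dunklGamma ν r) := fun r => by
    rw [← add_mul]; exact mul_le_mul_of_nonneg_right (step r) (hw r)
  have hs2 := h1.add (h0.mul_left c)
  have s2 : Summable fun r : ℕ => dunklShift ν (r + 1) * (y ^ r / dunklGamma ν r) :=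
    Summable.of_nonneg_of_le (fun r => mul_nonneg (dunklShift_nonneg hν _) (hw r)) h2' hs2.summable
  have b2 := hasSum_le h2' s2.hasSum hs2
  have h2 := hasSum_dunklShift_mul hν s2.hasSum
  simp only [← pow_two] at h2
  have b2' := mul_le_mul_of_nonneg_left b2 hy
  have h3' : ∀ r : ℕ, dunklShift ν (r + 1) ^ 2 * (y ^ r / dunklGamma ν r) ≤
      dunklShift ν r ^ 2 * (y ^ r / dunklGamma ν r) +
        2 * c * (dunklShift ν r * (y ^ r / dunklGamma ν r)) +
        c ^ 2 * (y ^ r / dunklGamma ν r) := fun r => by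
    have := mul_le_mul_of_nonneg_right
      (pow_le_pow_left₀ (dunklShift_nonneg hν (r + 1)) (step r) 2) (hw r)
    refine this.trans (le_of_eq ?_)
    ring
  have hs3 := (h2.add (h1.mul_left (2 * c))).add (h0.mul_left (c ^ 2))
  have s3 : Summable fun r : ℕ => dunklShift ν (r + 1) ^ 2 * (y ^ r / dunklGamma ν r) :=
    Summable.of_nonneg_of_le (fun r => mul_nonneg (sq_nonneg _) (hw r)) h3' hs3.summable
  have b3 := hasSum_le h3' s3.hasSum hs3
  have h3 := hasSum_dunklShift_mul (f := fun r => dunklShift ν r ^ 2) hν s3.hasSum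
  simp only [← pow_succ'] at h3
  have b3' := mul_le_mul_of_nonneg_left b3 hy
  refine ⟨h0, h1, ⟨_, h2, b2'.trans (le_of_eq (by ring))⟩, _, h3, ?_⟩
  have b2'' := mul_le_mul_of_nonneg_left b2' hy
  nlinarith [b3', b2'']

/-! ### Beta integrals and the means over a single weight -/

theorem integrableOn_Ioi_inv_one_add_pow (j : ℕ) :
    IntegrableOn (fun s : ℝ => 1 / (1 + s) ^ (j + 2)) (Ioi 0) ∧
      ∫ s in Ioi (0 : ℝ), 1 / (1 + s) ^ (j + 2) = 1 / (j + 1) := by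
  have hj : (j : ℝ) + 1 ≠ 0 := by positivity
  have hd : ∀ s ∈ Ici (0 : ℝ),
      HasDerivAt (fun s : ℝ => -(1 / (j + 1)) * ((1 + s) ^ (j + 1))⁻¹) (1 / (1 + s) ^ (j + 2)) s := by
    intro s hs
    have hs' : (1 + s) ≠ 0 := by have : (0 : ℝ) ≤ s := hs; positivity
    have h := ((((hasDerivAt_id s).const_add 1).pow (j + 1)).inv (pow_ne_zero _ hs')).const_mul
      (-(1 / ((j : ℝ) + 1)))
    refine h.congr_deriv ?_
    simp only [id, Pi.pow_apply]
    push_cast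
    field_simp
    simp [pow_succ]
    try ring
  have ht : Tendsto (fun s : ℝ => -(1 / ((j : ℝ) + 1)) * ((1 + s) ^ (j + 1))⁻¹) atTop (𝓝 0) := by
    have h1 : Tendsto (fun s : ℝ => (1 + s) ^ (j + 1)) atTop atTop :=
      (tendsto_pow_atTop (Nat.succ_ne_zero j)).comp (tendsto_atTop_add_const_left _ _ tendsto_id)
    simpa using h1.inv_tendsto_atTop.const_mul (-(1 / ((j : ℝ) + 1)))
  have hp : ∀ s ∈ Ioi (0 : ℝ), 0 ≤ 1 / (1 + s) ^ (j + 2) := by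
    intro s hs
    have : (0 : ℝ) < s := hs
    positivity
  have hi := integrableOn_Ioi_deriv_of_nonneg' hd hp ht
  refine ⟨hi, ?_⟩
  rw [integral_Ioi_of_hasDerivAt_of_tendsto' hd hi ht]
  simp

theorem pow_div_one_add_pow_le {s : ℝ} (hs : 0 ≤ s) (a j : ℕ) :
    s ^ a / (1 + s) ^ (a + j) ≤ 1 / (1 + s) ^ j := by
  rw [pow_add, div_le_div_iff₀ (by positivity) (by positivity), one_mul]
  gcongr
  linarith

theorem integrableOn_Ioi_pow_div_one_add_pow (a j : ℕ) :
    IntegrableOn (fun s : ℝ => s ^ a / (1 + s) ^ (a + j + 2)) (Ioi 0) := by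
  refine Integrable.mono' (integrableOn_Ioi_inv_one_add_pow j).1 ?_ ?_
  · exact (by fun_prop : Measurable fun s : ℝ => s ^ a / (1 + s) ^ (a + j + 2)).aestronglyMeasurable
  · refine (ae_restrict_iff' measurableSet_Ioi).2 (Eventually.of_forall fun s hs => ?_)
    have hs' : (0 : ℝ) ≤ s := le_of_lt hs
    rw [Real.norm_of_nonneg (by positivity), add_assoc]
    exact pow_div_one_add_pow_le hs' a (j + 2)

/-- The beta integral `B(a+1, j+1)` in its form on the half-line. -/
theorem integral_Ioi_pow_div_one_add_pow (a j : ℕ) :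
    ∫ s in Ioi (0 : ℝ), s ^ a / (1 + s) ^ (a + j + 2) = (a ! : ℝ) * j ! / (a + j + 1)! := by
  induction a with
  | zero =>
    have h := (integrableOn_Ioi_inv_one_add_pow j).2
    simp only [pow_zero, zero_add, Nat.factorial_zero, Nat.cast_one, one_mul]
    rw [h, Nat.factorial_succ]
    push_cast
    field_simp
  | succ a ih =>
    have i1 := integrableOn_Ioi_pow_div_one_add_pow a j
    have i2 := integrableOn_Ioi_pow_div_one_add_pow (a + 1) j
    -- This primitive vanishes at `0` and at infinity, so its derivative integrates to zero; that is
    -- the recurrence in `a`.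
    have hd : ∀ s ∈ Ici (0 : ℝ),
        HasDerivAt (fun s : ℝ => s ^ (a + 1) / (1 + s) ^ (a + j + 2))
          ((a + 1) * (s ^ a / (1 + s) ^ (a + j + 2)) -
            (a + j + 2) * (s ^ (a + 1) / (1 + s) ^ (a + 1 + j + 2))) s := by
      intro s hs
      have hs' : (1 + s) ≠ 0 := by have : (0 : ℝ) ≤ s := hs; positivity
      have h := ((hasDerivAt_id s).pow (a + 1)).div
        (((hasDerivAt_id s).const_add 1).pow (a + j + 2)) (pow_ne_zero _ hs')
      refine h.congr_deriv ?_
      simp only [id, Pi.pow_apply]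
      have e : a + 1 + j + 2 = (a + j + 2) + 1 := by ring
      have e' : a + j + 2 - 1 = a + j + 1 := by omega
      have e'' : a + j + 2 = a + j + 1 + 1 := by omega
      rw [e, e']
      push_cast
      rw [e'']
      field_simp
      simp only [pow_succ]
      ring
    have ht : Tendsto (fun s : ℝ => s ^ (a + 1) / (1 + s) ^ (a + j + 2)) atTop (𝓝 0) := by
      have h1 : Tendsto (fun s : ℝ => (1 + s) ^ (j + 1)) atTop atTop :=
        (tendsto_pow_atTop (Nat.succ_ne_zero j)).comp (tendsto_atTop_add_const_left _ _ tendsto_id)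
      refine tendsto_of_tendsto_of_tendsto_of_le_of_le' tendsto_const_nhds h1.inv_tendsto_atTop
        ?_ ?_
      · filter_upwards [eventually_ge_atTop 0] with s hs
        positivity
      · filter_upwards [eventually_ge_atTop 0] with s hs
        have := pow_div_one_add_pow_le hs (a + 1) (j + 1)
        rw [show a + 1 + (j + 1) = a + j + 2 by ring] at this
        simpa using this
    have h := integral_Ioi_of_hasDerivAt_of_tendsto' hd
      ((i1.const_mul _).sub (i2.const_mul _)) ht
    rw [integral_sub (i1.const_mul _) (i2.const_mul _), integral_const_mul, integral_const_mul,
      ih] at h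
    simp only [ne_eq, Nat.add_eq_zero_iff, one_ne_zero, and_false, not_false_eq_true, zero_pow,
      zero_div, sub_zero] at h
    have h2 : (a : ℝ) + j + 2 ≠ 0 := by positivity
    have h3 : ∫ s in Ioi (0 : ℝ), s ^ (a + 1) / (1 + s) ^ (a + 1 + j + 2) =
        (a + 1) * ((a ! : ℝ) * j ! / (a + j + 1)!) / (a + j + 2) := by
      rw [eq_div_iff h2]; linarith
    rw [h3, show a + 1 + j + 1 = (a + j + 1) + 1 by ring, Nat.factorial_succ (a + j + 1),
      Nat.factorial_succ a]
    push_cast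
    field_simp
    ring

/-- The mean of `g` that multiplies the `r`-th Dunkl weight in `T_n(g; x)`. -/
noncomputable def betaMean (n : ℕ) (g : ℝ → ℝ) : ℕ → ℝ
  | 0 => g 0
  | k + 1 => ((n : ℝ) - 1) * ((n + (k + 1) - 2).choose (k + 1 - 1) : ℝ) *
      ∫ s in Ioi (0 : ℝ), betaIntegrand n (k + 1) g s

/-- Here `k = r - 1`. The factor `s ^ m` only changes the parameters of the beta integral, to `a = k
+ m` and `j = n - 2 - m`; the bounds on `n` and `m` keep this subtraction from truncating. -/
theorem betaWeight_moment {n k m : ℕ} (hn : 5 ≤ n) (hm : m ≤ 3) :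
    IntegrableOn (fun s : ℝ => s ^ k / (1 + s) ^ (n + k) * s ^ m) (Ioi 0) ∧
      ((n : ℝ) - 1) * ((n + k - 1).choose k : ℝ) *
        ∫ s in Ioi (0 : ℝ), s ^ k / (1 + s) ^ (n + k) * s ^ m =
        ((k + m)! / k ! : ℝ) * ((n - 2 - m)! / (n - 2)! : ℝ) := by
  obtain ⟨N, rfl⟩ := Nat.exists_eq_add_of_le' hn
  obtain ⟨l, hl⟩ := Nat.exists_eq_add_of_le' hm
  have e : (fun s : ℝ => s ^ k / (1 + s) ^ (N + 5 + k) * s ^ m) =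
      fun s : ℝ => s ^ (k + m) / (1 + s) ^ (k + m + (N + l) + 2) := by
    funext s
    rw [show k + m + (N + l) + 2 = N + 5 + k by omega, pow_add]
    ring
  rw [e]
  refine ⟨integrableOn_Ioi_pow_div_one_add_pow _ _, ?_⟩
  rw [integral_Ioi_pow_div_one_add_pow, show k + m + (N + l) + 1 = N + 4 + k by omega,
    show N + 5 + k - 1 = N + 4 + k by omega, show N + 5 - 2 - m = N + l by omega,
    show N + 5 - 2 = N + 3 by omega, Nat.cast_choose ℝ (Nat.le_add_left k (N + 4)),
    Nat.add_sub_cancel, show (N + 4)! = (N + 4) * (N + 3)! from Nat.factorial_succ _]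
  push_cast
  field_simp
  ring

/-- The majorant is integrated with exact moments, so its coefficients may have any sign; in the
application those of `t` and `t ^ 2` can be negative. At `r = 0` only `p₀` survives, which matches
the point mass at `0`. -/
theorem abs_betaMean_sub_le {n : ℕ} (hn : 5 ≤ n) {g : ℝ → ℝ} (hg : ContinuousOn g (Ici 0))
    {c p₀ p₁ p₂ p₃ : ℝ} (h : ∀ t, 0 ≤ t → |g t - c| ≤ p₀ + p₁ * t + p₂ * t ^ 2 + p₃ * t ^ 3) :
    (∀ r, 1 ≤ r → IntegrableOn (betaIntegrand n r g) (Ioi 0)) ∧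
      ∀ r : ℕ, |betaMean n g r - c| ≤ p₀ + p₁ * (r / (n - 2)) +
        p₂ * (r * (r + 1) / ((n - 2) * (n - 3))) +
        p₃ * (r * (r + 1) * (r + 2) / ((n - 2) * (n - 3) * (n - 4))) := by
  have key : ∀ k : ℕ, IntegrableOn (betaIntegrand n (k + 1) g) (Ioi 0) ∧
      |betaMean n g (k + 1) - c| ≤ p₀ + p₁ * ((k + 1 : ℕ) / (n - 2)) +
        p₂ * ((k + 1 : ℕ) * ((k + 1 : ℕ) + 1) / ((n - 2) * (n - 3))) +
        p₃ * ((k + 1 : ℕ) * ((k + 1 : ℕ) + 1) * ((k + 1 : ℕ) + 2) /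
          ((n - 2) * (n - 3) * (n - 4))) := by
    intro k
    set b : ℝ → ℝ := fun s => s ^ k / (1 + s) ^ (n + k) with hb
    set κ : ℝ := ((n : ℝ) - 1) * ((n + k - 1).choose k : ℝ) with hκ
    obtain ⟨i0, m0⟩ := betaWeight_moment (k := k) (m := 0) hn (by norm_num)
    obtain ⟨i1, m1⟩ := betaWeight_moment (k := k) (m := 1) hn (by norm_num)
    obtain ⟨i2, m2⟩ := betaWeight_moment (k := k) (m := 2) hn (by norm_num)
    obtain ⟨i3, m3⟩ := betaWeight_moment (k := k) (m := 3) hn (by norm_num)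
    have hn' : (5 : ℝ) ≤ n := by exact_mod_cast hn
    have hκ0 : 0 ≤ κ := mul_nonneg (by linarith) (Nat.cast_nonneg _)
    have hb0 : ∀ s ∈ Ioi (0 : ℝ), 0 ≤ b s := fun s hs => by
      have : (0 : ℝ) < s := hs
      simp only [hb]; positivity
    have idom : IntegrableOn (fun s => p₀ * (b s * s ^ 0) + p₁ * (b s * s ^ 1) +
        p₂ * (b s * s ^ 2) + p₃ * (b s * s ^ 3)) (Ioi 0) :=
      (((i0.const_mul p₀).add (i1.const_mul p₁)).add (i2.const_mul p₂)).add (i3.const_mul p₃)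
    have hle : ∀ᵐ s ∂(volume.restrict (Ioi (0 : ℝ))), ‖b s * (g s - c)‖ ≤
        p₀ * (b s * s ^ 0) + p₁ * (b s * s ^ 1) + p₂ * (b s * s ^ 2) + p₃ * (b s * s ^ 3) := by
      refine (ae_restrict_iff' measurableSet_Ioi).2 (Eventually.of_forall fun s hs => ?_)
      rw [norm_mul, Real.norm_of_nonneg (hb0 s hs), Real.norm_eq_abs]
      refine (mul_le_mul_of_nonneg_left (h s (le_of_lt hs)) (hb0 s hs)).trans (le_of_eq ?_)
      ring
    have hbm : Measurable b := by simp only [hb]; fun_prop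
    have hgm : AEStronglyMeasurable g (volume.restrict (Ioi 0)) :=
      (hg.mono Ioi_subset_Ici_self).aestronglyMeasurable measurableSet_Ioi
    have isub : IntegrableOn (fun s => b s * (g s - c)) (Ioi 0) :=
      Integrable.mono' idom (hbm.aestronglyMeasurable.mul (hgm.sub aestronglyMeasurable_const)) hle
    have eg : betaIntegrand n (k + 1) g = fun s => b s * (g s - c) + c * (b s * s ^ 0) := by
      funext s
      simp only [betaIntegrand, hb, Nat.add_sub_cancel, ← Nat.add_assoc]
      ring
    have ig : IntegrableOn (betaIntegrand n (k + 1) g) (Ioi 0) := by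
      rw [eg]; exact isub.add (i0.const_mul c)
    refine ⟨ig, ?_⟩
    have f1 : ((k + 1)! : ℝ) = (k + 1) * k ! := by rw [Nat.factorial_succ]; push_cast; ring
    have f2 : ((k + 2)! : ℝ) = (k + 2) * (k + 1) * k ! := by
      rw [Nat.factorial_succ, Nat.cast_mul, f1]; push_cast; ring
    have f3 : ((k + 3)! : ℝ) = (k + 3) * (k + 2) * (k + 1) * k ! := by
      rw [Nat.factorial_succ, Nat.cast_mul, f2]; push_cast; ring
    obtain ⟨N, rfl⟩ := Nat.exists_eq_add_of_le' hn
    have hk : (k ! : ℝ) ≠ 0 := by positivity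
    have hN : (N ! : ℝ) ≠ 0 := by positivity
    have g1 : ((N + 1)! : ℝ) = (N + 1) * N ! := by rw [Nat.factorial_succ]; push_cast; ring
    have g2 : ((N + 2)! : ℝ) = (N + 2) * (N + 1) * N ! := by
      rw [Nat.factorial_succ, Nat.cast_mul, g1]; push_cast; ring
    have g3 : ((N + 3)! : ℝ) = (N + 3) * (N + 2) * (N + 1) * N ! := by
      rw [Nat.factorial_succ, Nat.cast_mul, g2]; push_cast; ring
    have q2 : ((N + 5 : ℕ) : ℝ) - 2 = N + 3 := by push_cast; ring
    have q3 : ((N + 5 : ℕ) : ℝ) - 3 = N + 2 := by push_cast; ring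
    have q4 : ((N + 5 : ℕ) : ℝ) - 4 = N + 1 := by push_cast; ring
    have m0' : κ * ∫ s in Ioi (0 : ℝ), b s * s ^ 0 = 1 := by
      rw [hκ, m0]; simp only [Nat.add_zero, Nat.sub_zero]
      rw [div_self hk, div_self (by positivity), one_mul]
    have m1' : κ * ∫ s in Ioi (0 : ℝ), b s * s ^ 1 = (k + 1) / (N + 3) := by
      rw [hκ, m1, show N + 5 - 2 - 1 = N + 2 by omega, show N + 5 - 2 = N + 3 by omega, f1, g2, g3]
      field_simp
    have m2' : κ * ∫ s in Ioi (0 : ℝ), b s * s ^ 2 =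
        (k + 1) * (k + 2) / ((N + 3) * (N + 2)) := by
      rw [hκ, m2, show N + 5 - 2 - 2 = N + 1 by omega, show N + 5 - 2 = N + 3 by omega, f2, g1, g3]
      field_simp
    have m3' : κ * ∫ s in Ioi (0 : ℝ), b s * s ^ 3 =
        (k + 1) * (k + 2) * (k + 3) / ((N + 3) * (N + 2) * (N + 1)) := by
      rw [hκ, m3, show N + 5 - 2 - 3 = N by omega, show N + 5 - 2 = N + 3 by omega, f3, g3]
      field_simp
    have hL : betaMean (N + 5) g (k + 1) - c = κ * ∫ s in Ioi (0 : ℝ), b s * (g s - c) := by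
      have : betaMean (N + 5) g (k + 1) =
          κ * ∫ s in Ioi (0 : ℝ), betaIntegrand (N + 5) (k + 1) g s := by
        simp only [betaMean, hκ, Nat.add_sub_cancel]
        rw [show N + 5 + (k + 1) - 2 = N + 5 + k - 1 by omega]
      rw [this, eg, integral_add isub (i0.const_mul c), integral_const_mul, mul_add,
        mul_left_comm κ c, m0']
      ring
    have hI : ∫ s in Ioi (0 : ℝ), (p₀ * (b s * s ^ 0) + p₁ * (b s * s ^ 1) +
        p₂ * (b s * s ^ 2) + p₃ * (b s * s ^ 3)) =
        p₀ * (∫ s in Ioi (0 : ℝ), b s * s ^ 0) + p₁ * (∫ s in Ioi (0 : ℝ), b s * s ^ 1) +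
        p₂ * (∫ s in Ioi (0 : ℝ), b s * s ^ 2) + p₃ * (∫ s in Ioi (0 : ℝ), b s * s ^ 3) := by
      have j0 : IntegrableOn (fun s => p₀ * (b s * s ^ 0)) (Ioi 0) := i0.const_mul p₀
      have j1 : IntegrableOn (fun s => p₁ * (b s * s ^ 1)) (Ioi 0) := i1.const_mul p₁
      have j2 : IntegrableOn (fun s => p₂ * (b s * s ^ 2)) (Ioi 0) := i2.const_mul p₂
      have j3 : IntegrableOn (fun s => p₃ * (b s * s ^ 3)) (Ioi 0) := i3.const_mul p₃
      have j01 : IntegrableOn (fun s => p₀ * (b s * s ^ 0) + p₁ * (b s * s ^ 1)) (Ioi 0) :=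
        j0.add j1
      have j012 : IntegrableOn (fun s => p₀ * (b s * s ^ 0) + p₁ * (b s * s ^ 1) +
          p₂ * (b s * s ^ 2)) (Ioi 0) := j01.add j2
      rw [integral_add j012 j3, integral_add j01 j2, integral_add j0 j1]
      simp only [integral_const_mul]
    have hfin := mul_le_mul_of_nonneg_left (norm_integral_le_of_norm_le idom hle) hκ0
    rw [hI] at hfin
    rw [hL, abs_mul, abs_of_nonneg hκ0, q2, q3, q4, ← Real.norm_eq_abs]
    refine hfin.trans (le_of_eq ?_)
    calc _ = p₀ * (κ * ∫ s in Ioi (0 : ℝ), b s * s ^ 0) +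
          p₁ * (κ * ∫ s in Ioi (0 : ℝ), b s * s ^ 1) +
          p₂ * (κ * ∫ s in Ioi (0 : ℝ), b s * s ^ 2) +
          p₃ * (κ * ∫ s in Ioi (0 : ℝ), b s * s ^ 3) := by ring
      _ = _ := by
        rw [m0', m1', m2', m3']
        push_cast
        ring
  refine ⟨fun r hr => ?_, fun r => ?_⟩
  · obtain ⟨k, rfl⟩ := Nat.exists_eq_add_of_le' hr
    exact (key k).1
  · cases r with
    | zero => simpa [betaMean] using h 0 le_rfl
    | succ k => exact (key k).2

/-! ### The weighted modulus of continuity -/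

theorem weightedModulus_nonneg (g : ℝ → ℝ) (δ : ℝ) : 0 ≤ weightedModulus g δ := by
  refine Real.sSup_nonneg ?_
  rintro q ⟨x, h, -, -, -, rfl⟩
  positivity

theorem abs_sub_le_weightedModulus {g : ℝ → ℝ} (hg : g ∈ CRhoStar) {δ x h : ℝ} (hx : 0 ≤ x)
    (hxh : 0 ≤ x + h) (hh : |h| ≤ δ) :
    |g (x + h) - g x| ≤ weightedModulus g δ * ((1 + h ^ 2) * (1 + x ^ 2)) := by
  rw [← div_le_iff₀ (by positivity)]
  exact le_csSup (weightedQuotients_bddAbove hg δ) ⟨x, h, hx, hxh, hh, rfl⟩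

theorem abs_sub_le_of_weightedModulus {g : ℝ → ℝ} (hg : g ∈ CRhoStar) {δ x t : ℝ} (hδ : 0 < δ)
    (hx : 0 ≤ x) (ht : 0 ≤ t) :
    |g t - g x| ≤ 2 * (1 + δ ^ 2) * weightedModulus g δ * (1 + x ^ 2) *
      ((1 + |t - x| / δ) * (1 + (t - x) ^ 2)) := by
  have hΩ := weightedModulus_nonneg g δ
  set Ω := weightedModulus g δ
  -- The path from `x` to `t` is cut into `N` equal steps; adding `1` makes each at most `δ` and
  -- keeps `N` positive when `t = x`.
  set N : ℕ := ⌊|t - x| / δ⌋₊ + 1 with hN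
  have hN0 : (0 : ℝ) < N := by rw [hN]; positivity
  have hNle : (N : ℝ) ≤ 1 + |t - x| / δ := by
    have := Nat.floor_le (div_nonneg (abs_nonneg (t - x)) hδ.le)
    rw [hN]; push_cast; linarith
  have hNge : |t - x| / δ ≤ N := by
    rw [hN]; push_cast; exact (Nat.lt_floor_add_one _).le
  set h := (t - x) / N with hh
  have hhδ : |h| ≤ δ := by
    rw [hh, abs_div, abs_of_pos hN0, div_le_iff₀ hN0]
    rwa [div_le_iff₀ hδ, mul_comm] at hNge
  -- Each node is a convex combination of `x` and `t`, hence in the domain, and its weight is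
  -- controlled by `(x + u)² ≤ 2x² + 2u²`.
  have pos : ∀ j : ℕ, j ≤ N → 0 ≤ x + j * h ∧
      1 + (x + j * h) ^ 2 ≤ 2 * (1 + x ^ 2) * (1 + (t - x) ^ 2) := by
    intro j hj
    have hj1 : (j : ℝ) / N ≤ 1 := by
      rw [div_le_one hN0]; exact_mod_cast hj
    have hj0 : 0 ≤ (j : ℝ) / N := by positivity
    have e : (j : ℝ) * h = j / N * (t - x) := by rw [hh]; ring
    rw [e]
    set l := (j : ℝ) / N
    refine ⟨by nlinarith, ?_⟩
    have : (l * (t - x)) ^ 2 ≤ (t - x) ^ 2 := by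
      rw [mul_pow]
      exact mul_le_of_le_one_left (sq_nonneg _) (pow_le_one₀ hj0 hj1)
    nlinarith [sq_nonneg (x - l * (t - x)), mul_nonneg (sq_nonneg x) (sq_nonneg (t - x))]
  have hstep : ∀ j ∈ Finset.range N, |g (x + (j + 1 : ℕ) * h) - g (x + j * h)| ≤
      Ω * ((1 + δ ^ 2) * (2 * (1 + x ^ 2) * (1 + (t - x) ^ 2))) := by
    intro j hj
    have hj' := Finset.mem_range.1 hj
    obtain ⟨a1, a2⟩ := pos j hj'.le
    obtain ⟨b1, -⟩ := pos (j + 1) hj'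
    have e : x + ((j + 1 : ℕ) : ℝ) * h = x + j * h + h := by push_cast; ring
    rw [e] at b1 ⊢
    refine (abs_sub_le_weightedModulus hg a1 b1 hhδ).trans ?_
    refine mul_le_mul_of_nonneg_left ?_ hΩ
    have : h ^ 2 ≤ δ ^ 2 := by
      rw [← sq_abs h]; exact pow_le_pow_left₀ (abs_nonneg _) hhδ 2
    exact mul_le_mul (by linarith) a2 (by positivity) (by positivity)
  have htel := Finset.sum_range_sub (fun j : ℕ => g (x + j * h)) N
  have eN : x + (N : ℝ) * h = t := by rw [hh]; field_simp; ring
  simp only [eN, Nat.cast_zero, zero_mul, add_zero] at htel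
  rw [← htel]
  refine (Finset.abs_sum_le_sum_abs _ _).trans ((Finset.sum_le_sum hstep).trans ?_)
  rw [Finset.sum_const, Finset.card_range, nsmul_eq_mul]
  have := mul_le_mul_of_nonneg_right hNle
    (by positivity : 0 ≤ Ω * ((1 + δ ^ 2) * (2 * (1 + x ^ 2) * (1 + (t - x) ^ 2))))
  refine this.trans (le_of_eq ?_)
  ring

/-- The odd powers of `|t - x|` must go, since only polynomial moments are available. The first is
absorbed by the arithmetic-geometric mean inequality, the third by `|t - x| ≤ t + x`, which avoids a
fourth moment. -/
theorem abs_sub_le_cubic {g : ℝ → ℝ} (hg : g ∈ CRhoStar) {n : ℕ} (hn : 2 ≤ n) {x t : ℝ}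
    (hx : 0 ≤ x) (ht : 0 ≤ t) :
    |g t - g x| ≤ 2 * (1 + 1 / (n : ℝ)) * weightedModulus g (1 / Real.sqrt n) * (1 + x ^ 2) *
      (3 / 2 + n * ((t - x) ^ 2 * (1 + t + x))) := by
  have hn' : (2 : ℝ) ≤ n := by exact_mod_cast hn
  have hs : 0 < Real.sqrt n := Real.sqrt_pos.2 (by linarith)
  have hs2 : Real.sqrt n ^ 2 = n := Real.sq_sqrt (by linarith)
  have h := abs_sub_le_of_weightedModulus hg (one_div_pos.2 hs) hx ht
  rw [div_pow, hs2, one_pow] at h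
  refine h.trans (mul_le_mul_of_nonneg_left ?_ ?_)
  · rw [div_div_eq_mul_div, div_one]
    set σ := Real.sqrt n
    have h1 : σ ≤ n := by rw [← hs2]; nlinarith
    have h2 : |t - x| ≤ t + x := abs_sub_le_iff.2 ⟨by linarith, by linarith⟩
    have h3 : |t - x| * σ ≤ (1 + n * (t - x) ^ 2) / 2 := by
      rw [← hs2, ← sq_abs (t - x)]
      nlinarith [sq_nonneg (1 - |t - x| * σ)]
    have h4 : |t - x| * σ ≤ (t + x) * n :=
      mul_le_mul h2 h1 hs.le (by positivity)
    have h5 := mul_le_mul_of_nonneg_right h4 (sq_nonneg (t - x))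
    nlinarith [mul_nonneg (sub_nonneg.2 hn') (sq_nonneg (t - x))]
  · have := weightedModulus_nonneg g (1 / Real.sqrt n)
    positivity

/-! ### The cubic moment of `T_n` -/

/-- The left side is the conditional mean of `(t-x)² (1+t+x)` given `r`. On the right, the square
and cube of `dunklShift` have nonnegative coefficients, so upper bounds for their moments are
enough. -/
theorem mean_cubic_le_shift {ν : ℝ} (hν : 0 ≤ ν) {n : ℕ} (hn : 5 ≤ n) {x : ℝ} (hx : 0 ≤ x)
    (r : ℕ) :
    (x ^ 2 + x ^ 3) - (2 * x + x ^ 2) * (r / (n - 2)) +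
        (1 - x) * (r * (r + 1) / ((n - 2) * (n - 3))) +
        r * (r + 1) * (r + 2) / ((n - 2) * (n - 3) * (n - 4)) ≤
      (x * (4 * ν * (n * x) + (n * x) ^ 2) / ((n - 2) * (n - 3)) +
          2 * ν * (2 * x + x ^ 2) / (n - 2) + x ^ 2 + x ^ 3) +
        (2 / ((n - 2) * (n - 3) * (n - 4)) + 1 / ((n - 2) * (n - 3)) -
          2 * x * (n * x) / ((n - 2) * (n - 3)) - (2 * x + x ^ 2) / (n - 2)) * dunklShift ν r +
        (3 / ((n - 2) * (n - 3) * (n - 4)) + 1 / ((n - 2) * (n - 3))) * dunklShift ν r ^ 2 +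
        1 / ((n - 2) * (n - 3) * (n - 4)) * dunklShift ν r ^ 3 := by
  have hn' : (5 : ℝ) ≤ n := by exact_mod_cast hn
  have ha1 := le_dunklShift hν r
  have ha2 := dunklShift_le hν r
  have hr : (0 : ℝ) ≤ r := Nat.cast_nonneg r
  generalize dunklShift ν r = a at *
  generalize (r : ℝ) = ρ at *
  have m1 : (0 : ℝ) < n - 2 := by linarith
  have m2 : (0 : ℝ) < (n - 2) * (n - 3) := mul_pos m1 (by linarith)
  have m3 : (0 : ℝ) < (n - 2) * (n - 3) * (n - 4) := mul_pos m2 (by linarith)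
  have i1 : 0 ≤ ((n : ℝ) - 2)⁻¹ := by positivity
  have i2 : 0 ≤ (((n : ℝ) - 2) * (n - 3))⁻¹ := by positivity
  have i3 : 0 ≤ (((n : ℝ) - 2) * (n - 3) * (n - 4))⁻¹ := by positivity
  simp only [div_eq_mul_inv]
  generalize ((n : ℝ) - 2)⁻¹ = j1 at *
  generalize (((n : ℝ) - 2) * (n - 3))⁻¹ = j2 at *
  generalize (((n : ℝ) - 2) * (n - 3) * (n - 4))⁻¹ = j3 at *
  set y := (n : ℝ) * x with hy
  have hy0 : 0 ≤ y := by positivity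
  have ha0 : 0 ≤ a := hr.trans ha1
  have e3 : ρ * (ρ + 1) * (ρ + 2) ≤ a ^ 3 + 3 * a ^ 2 + 2 * a := by
    have : ρ * (ρ + 1) * (ρ + 2) ≤ a * (a + 1) * (a + 2) := by gcongr
    linarith
  have e2 : ρ * (ρ + 1) ≤ a ^ 2 + a := by nlinarith
  -- The term `-x ρ (ρ + 1)` needs a lower bound whose mean is known exactly. The tangent `ρ² ≥ 2yρ
  -- - y²` at the mean `y` of the shifted index is linear, hence serves.
  have e2' : 2 * y * (a - 2 * ν) - y ^ 2 ≤ ρ * (ρ + 1) := by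
    nlinarith [sq_nonneg (ρ - y), mul_nonneg hy0 (by linarith : 0 ≤ ρ - (a - 2 * ν))]
  have e1 : a - 2 * ν ≤ ρ := by linarith
  have f3 := mul_le_mul_of_nonneg_right e3 i3
  have f2 := mul_le_mul_of_nonneg_right e2 i2
  have f2' := mul_le_mul_of_nonneg_right (mul_le_mul_of_nonneg_left e2' hx) i2
  have f1 := mul_le_mul_of_nonneg_right
    (mul_le_mul_of_nonneg_left e1 (by positivity : 0 ≤ 2 * x + x ^ 2)) i1
  linarith

/-- With every `u` equal to `1` and `z = 0` the left side vanishes identically. Upper bounds on `u`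
are used in positive terms and `u ≥ 1` in negative ones, so every remaining term carries a factor
`z`. -/
theorem cubic_moment_bound_normalized {ν c x z u₁ u₂ u₃ : ℝ} (hx : 0 ≤ x) (hν : 0 ≤ ν)
    (hc : c = 1 + 2 * ν) (z0 : 0 < z) (z1 : z ≤ 1 / 5) (a1 : 1 ≤ u₁) (b1 : u₁ ≤ 5 / 3)
    (a2 : 1 ≤ u₂) (b2 : u₂ ≤ 1 + 16 * z) (b3 : u₃ ≤ 1 + 100 * z) :
    u₃ * (x ^ 3 + 3 * c * x ^ 2 * z + c ^ 2 * x * z ^ 2) +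
        (x ^ 2 + c * x * z) * (3 * u₃ * z + u₂) + x * (2 * u₃ * z ^ 2 + u₂ * z) - x ^ 3 * u₂ -
        (2 * x ^ 2 + x ^ 3) * u₁ + 4 * ν * x ^ 2 * u₂ * z + 2 * ν * (2 * x + x ^ 2) * u₁ * z +
        x ^ 2 + x ^ 3 ≤
      200 * c ^ 2 * z * (1 + x ^ 2) ^ 2 := by
  have hu3' : u₃ ≤ 21 := by linarith
  have hu2' : u₂ ≤ 5 := by linarith
  have hνc : ν ≤ c := by linarith
  have c1 : 1 ≤ c := by linarith
  have t1 : u₃ * x ^ 3 ≤ (1 + 100 * z) * x ^ 3 := by gcongr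
  have t2 : u₃ * (3 * c * x ^ 2 * z) ≤ 21 * (3 * c * x ^ 2 * z) := by gcongr
  have t3 : u₃ * (c ^ 2 * x * z ^ 2) ≤ 21 * (c ^ 2 * x * z) := by
    have : z ^ 2 ≤ z := by nlinarith
    gcongr
  have t4 : x ^ 2 * (3 * u₃ * z) ≤ x ^ 2 * (3 * 21 * z) := by gcongr
  have t5 : x ^ 2 * u₂ ≤ x ^ 2 * (1 + 16 * z) := by gcongr
  have t6 : c * x * z * (3 * u₃ * z + u₂) ≤ c * x * z * (3 * 21 * 1 + 5) := by
    gcongr; linarith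
  have t7 : x * (2 * u₃ * z ^ 2 + u₂ * z) ≤ x * (2 * 21 * z + 5 * z) := by
    have : z ^ 2 ≤ z := by nlinarith
    gcongr
  have t8 : x ^ 3 * 1 ≤ x ^ 3 * u₂ := by gcongr
  have t9 : (2 * x ^ 2 + x ^ 3) * 1 ≤ (2 * x ^ 2 + x ^ 3) * u₁ := by gcongr
  have t10 : 4 * ν * x ^ 2 * u₂ * z ≤ 4 * c * x ^ 2 * 5 * z := by gcongr
  have t11 : 2 * ν * (2 * x + x ^ 2) * u₁ * z ≤ 2 * c * (2 * x + x ^ 2) * 2 * z := by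
    gcongr; linarith
  have hcc : c ≤ c ^ 2 := by nlinarith
  have h1c : 1 ≤ c ^ 2 := by linarith
  have s1 : c * (x * z) ≤ c ^ 2 * (x * z) := by gcongr
  have s2 : 1 * (x * z) ≤ c ^ 2 * (x * z) := by gcongr
  have s3 : c * (x ^ 2 * z) ≤ c ^ 2 * (x ^ 2 * z) := by gcongr
  have s4 : 1 * (x ^ 2 * z) ≤ c ^ 2 * (x ^ 2 * z) := by gcongr
  have s5 : 1 * (x ^ 3 * z) ≤ c ^ 2 * (x ^ 3 * z) := by gcongr
  have hpoly : x + x ^ 2 + x ^ 3 ≤ (1 + x ^ 2) ^ 2 := by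
    nlinarith [sq_nonneg (x - 1), sq_nonneg (x ^ 2 - x), sq_nonneg (x ^ 2), sq_nonneg x]
  have hp : 200 * c ^ 2 * z * (x + x ^ 2 + x ^ 3) ≤ 200 * c ^ 2 * z * (1 + x ^ 2) ^ 2 := by gcongr
  refine le_trans ?_ hp
  have p1 : 0 ≤ c ^ 2 * (x * z) := by positivity
  have p2 : 0 ≤ c ^ 2 * (x ^ 2 * z) := by positivity
  have p3 : 0 ≤ c ^ 2 * (x ^ 3 * z) := by positivity
  linarith

theorem cubic_moment_bound {ν : ℝ} (hν : 0 ≤ ν) {n : ℝ} (hn : 5 ≤ n) {x : ℝ} (hx : 0 ≤ x) :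
    (x * (4 * ν * (n * x) + (n * x) ^ 2) / ((n - 2) * (n - 3)) +
          2 * ν * (2 * x + x ^ 2) / (n - 2) + x ^ 2 + x ^ 3) +
        (2 / ((n - 2) * (n - 3) * (n - 4)) + 1 / ((n - 2) * (n - 3)) -
          2 * x * (n * x) / ((n - 2) * (n - 3)) - (2 * x + x ^ 2) / (n - 2)) * (n * x) +
        (3 / ((n - 2) * (n - 3) * (n - 4)) + 1 / ((n - 2) * (n - 3))) *
          (n * x * (n * x + (1 + 2 * ν))) +
        1 / ((n - 2) * (n - 3) * (n - 4)) *
          (n * x * ((n * x) ^ 2 + 3 * (1 + 2 * ν) * (n * x) + (1 + 2 * ν) ^ 2)) ≤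
      200 * (1 + 2 * ν) ^ 2 / n * (1 + x ^ 2) ^ 2 := by
  have m1 : 0 < n - 2 := by linarith
  have m2 : 0 < n - 3 := by linarith
  have m3 : 0 < n - 4 := by linarith
  have n0 : 0 < n := by linarith
  obtain ⟨z, hz⟩ : ∃ z, z = 1 / n := ⟨_, rfl⟩
  obtain ⟨u₁, hu₁⟩ : ∃ u, u = n / (n - 2) := ⟨_, rfl⟩
  obtain ⟨u₂, hu₂⟩ : ∃ u, u = n ^ 2 / ((n - 2) * (n - 3)) := ⟨_, rfl⟩
  obtain ⟨u₃, hu₃⟩ : ∃ u, u = n ^ 3 / ((n - 2) * (n - 3) * (n - 4)) := ⟨_, rfl⟩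
  have z0 : 0 < z := by rw [hz]; positivity
  have z1 : z ≤ 1 / 5 := by rw [hz]; exact one_div_le_one_div_of_le (by norm_num) hn
  have a1 : 1 ≤ u₁ := by rw [hu₁, le_div_iff₀ m1]; linarith
  have b1 : u₁ ≤ 5 / 3 := by rw [hu₁, div_le_iff₀ m1]; linarith
  have a2 : 1 ≤ u₂ := by rw [hu₂, le_div_iff₀ (by positivity)]; nlinarith
  -- The constants `16` and `100` are dictated by `n = 5`, where the two bounds read `25/6 ≤ 21/5`
  -- and `125/6 ≤ 21`.
  have b2 : u₂ ≤ 1 + 16 * z := by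
    rw [hu₂, hz, div_le_iff₀ (by positivity)]
    rw [show 1 + 16 * (1 / n) = (n + 16) / n by field_simp, div_mul_eq_mul_div, le_div_iff₀ n0]
    nlinarith [mul_nonneg (sub_nonneg.2 hn) (sub_nonneg.2 hn)]
  have b3 : u₃ ≤ 1 + 100 * z := by
    rw [hu₃, hz, div_le_iff₀ (by positivity)]
    rw [show 1 + 100 * (1 / n) = (n + 100) / n by field_simp, div_mul_eq_mul_div, le_div_iff₀ n0]
    obtain ⟨d, rfl⟩ : ∃ d, n = d + 5 := ⟨n - 5, by ring⟩
    have hd : 0 ≤ d := by linarith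
    nlinarith [pow_nonneg hd 2, pow_nonneg hd 3]
  obtain ⟨c, hc⟩ : ∃ c, c = 1 + 2 * ν := ⟨_, rfl⟩
  have e : (x * (4 * ν * (n * x) + (n * x) ^ 2) / ((n - 2) * (n - 3)) +
          2 * ν * (2 * x + x ^ 2) / (n - 2) + x ^ 2 + x ^ 3) +
        (2 / ((n - 2) * (n - 3) * (n - 4)) + 1 / ((n - 2) * (n - 3)) -
          2 * x * (n * x) / ((n - 2) * (n - 3)) - (2 * x + x ^ 2) / (n - 2)) * (n * x) +
        (3 / ((n - 2) * (n - 3) * (n - 4)) + 1 / ((n - 2) * (n - 3))) *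
          (n * x * (n * x + c)) +
        1 / ((n - 2) * (n - 3) * (n - 4)) *
          (n * x * ((n * x) ^ 2 + 3 * c * (n * x) + c ^ 2)) =
      u₃ * (x ^ 3 + 3 * c * x ^ 2 * z + c ^ 2 * x * z ^ 2) +
        (x ^ 2 + c * x * z) * (3 * u₃ * z + u₂) + x * (2 * u₃ * z ^ 2 + u₂ * z) - x ^ 3 * u₂ -
        (2 * x ^ 2 + x ^ 3) * u₁ + 4 * ν * x ^ 2 * u₂ * z + 2 * ν * (2 * x + x ^ 2) * u₁ * z +
        x ^ 2 + x ^ 3 := by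
    rw [hu₃, hu₂, hu₁, hz]
    field_simp
    ring
  rw [← hc, e, show 200 * c ^ 2 / n = 200 * c ^ 2 * z by rw [hz]; ring]
  exact cubic_moment_bound_normalized hx (by linarith) hc z0 z1 a1 b1 a2 b2 b3

/-- The moment `E[(t - x)²(1 + t + x)]` of the Dunkl-beta law, before division by `e_ν(nx)`. -/
theorem exists_hasSum_cubic {ν : ℝ} (hν : 0 ≤ ν) {n : ℕ} (hn : 5 ≤ n) {x : ℝ} (hx : 0 ≤ x) :
    ∃ (U : ℕ → ℝ) (S : ℝ),
      (∀ r : ℕ, (x ^ 2 + x ^ 3) - (2 * x + x ^ 2) * (r / (n - 2)) +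
        (1 - x) * (r * (r + 1) / ((n - 2) * (n - 3))) +
        r * (r + 1) * (r + 2) / ((n - 2) * (n - 3) * (n - 4)) ≤ U r) ∧
      HasSum (fun r => U r * ((n * x) ^ r / dunklGamma ν r)) S ∧
      S ≤ 200 * (1 + 2 * ν) ^ 2 / n * (1 + x ^ 2) ^ 2 * dunklExp ν (n * x) := by
  have hn' : (5 : ℝ) ≤ n := by exact_mod_cast hn
  have hy : 0 ≤ (n : ℝ) * x := by positivity
  obtain ⟨h0, h1, ⟨A₂, h2, hA2⟩, A₃, h3, hA3⟩ := dunklShift_moments hν hy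
  have hW := dunklExp_pos hν hy
  have hb := cubic_moment_bound hν hn' hx
  have hp := mean_cubic_le_shift hν hn hx
  have m1 : (0 : ℝ) < n - 2 := by linarith
  have m2 : (0 : ℝ) < n - 3 := by linarith
  have m3 : (0 : ℝ) < n - 4 := by linarith
  -- Signs matter only for the coefficients of `A₂` and `A₃`, which are bounded from above; the
  -- zeroth and first moments are exact.
  have c2 : 0 ≤ 3 / (((n : ℝ) - 2) * (n - 3) * (n - 4)) + 1 / ((n - 2) * (n - 3)) := by positivity
  have c3 : 0 ≤ 1 / (((n : ℝ) - 2) * (n - 3) * (n - 4)) := by positivity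
  generalize x * (4 * ν * (n * x) + (n * x) ^ 2) / (((n : ℝ) - 2) * (n - 3)) +
    2 * ν * (2 * x + x ^ 2) / (n - 2) + x ^ 2 + x ^ 3 = b₀ at hb hp
  generalize 2 / (((n : ℝ) - 2) * (n - 3) * (n - 4)) + 1 / ((n - 2) * (n - 3)) -
    2 * x * (n * x) / ((n - 2) * (n - 3)) - (2 * x + x ^ 2) / (n - 2) = b₁ at hb hp
  generalize 3 / (((n : ℝ) - 2) * (n - 3) * (n - 4)) + 1 / ((n - 2) * (n - 3)) = b₂ at hb hp c2
  generalize 1 / (((n : ℝ) - 2) * (n - 3) * (n - 4)) = b₃ at hb hp c3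
  refine ⟨_, b₀ * dunklExp ν (n * x) + b₁ * (n * x * dunklExp ν (n * x)) + b₂ * A₂ + b₃ * A₃,
    hp, ?_, ?_⟩
  · simpa only [add_mul, mul_assoc] using (((h0.mul_left b₀).add (h1.mul_left b₁)).add
      (h2.mul_left b₂)).add (h3.mul_left b₃)
  · have q2 := mul_le_mul_of_nonneg_left hA2 c2
    have q3 := mul_le_mul_of_nonneg_left hA3 c3
    have q := mul_le_mul_of_nonneg_right hb hW.le
    linarith

/-- Since `γ_ν(0) = 1`, the separate `g 0` in the operator is exactly the term `r = 0` of the full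
series of means. -/
theorem hasSum_betaMean_iff {ν : ℝ} (hν : 0 ≤ ν) {n : ℕ} {g : ℝ → ℝ} {x s : ℝ} :
    HasSum (fun r => betaMean n g r * ((n * x) ^ r / dunklGamma ν r)) s ↔
      HasSum (fun k => ((n : ℝ) - 1) * szaszBetaTerm ν n g x (k + 1)) (s - g 0) := by
  rw [← hasSum_nat_add_iff' 1]
  simp only [Finset.range_one, Finset.sum_singleton, betaMean, szaszBetaTerm, pow_zero,
    dunklGamma_zero hν, div_one, mul_one]
  refine iff_of_eq (congrArg (fun f => HasSum f _) (funext fun k => ?_))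
  ring

/-- One termwise majorant of the series of `betaMean n g r - g x` gives both convergence and the
estimate. In the constant, `3 = 2 · 3/2` and `400 = 2 · 200`, the `2` coming from `K`. -/
theorem szaszBeta_sub_bound {ν : ℝ} (hν : 0 ≤ ν) {n : ℕ} (hn : 5 ≤ n) {g : ℝ → ℝ}
    (hg : g ∈ CRhoStar) {x : ℝ} (hx : 0 ≤ x) :
    SzaszBetaDefined ν n g x ∧
      |szaszBeta ν n g x - g x| / (1 + x ^ 2) ^ 3 ≤
        (3 + 400 * (1 + 2 * ν) ^ 2) * (1 + 1 / (n : ℝ)) *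
          weightedModulus g (1 / Real.sqrt n) := by
  have hn' : (5 : ℝ) ≤ n := by exact_mod_cast hn
  have hy : 0 ≤ (n : ℝ) * x := by positivity
  have hΩ := weightedModulus_nonneg g (1 / Real.sqrt n)
  have hpt := fun t (ht : 0 ≤ t) => abs_sub_le_cubic hg (by omega : 2 ≤ n) hx ht
  set Ω := weightedModulus g (1 / Real.sqrt n)
  set K := 2 * (1 + 1 / (n : ℝ)) * Ω * (1 + x ^ 2) with hK
  have hK0 : 0 ≤ K := by positivity
  obtain ⟨hint, hmean⟩ := abs_betaMean_sub_le hn hg.1 (c := g x)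
    (p₀ := K * (3 / 2) + K * n * (x ^ 2 + x ^ 3)) (p₁ := -(K * n * (2 * x + x ^ 2)))
    (p₂ := K * n * (1 - x)) (p₃ := K * n) (fun t ht => (hpt t ht).trans (le_of_eq (by ring)))
  obtain ⟨U, S, hU, hS, hSle⟩ := exists_hasSum_cubic hν hn hx
  have hW := dunklExp_pos hν hy
  have hsw := summable_dunklExp hν hy
  have h0 : HasSum (fun r : ℕ => (n * x) ^ r / dunklGamma ν r) (dunklExp ν (n * x)) := hsw.hasSum
  set W := dunklExp ν (n * x)
  set w : ℕ → ℝ := fun r => (n * x) ^ r / dunklGamma ν r with hw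
  have hw0 : ∀ r, 0 ≤ w r := fun r => div_nonneg (pow_nonneg hy r) (dunklGamma_pos hν r).le
  have hdom : HasSum (fun r => K * (3 / 2) * w r + K * n * (U r * w r))
      (K * (3 / 2) * W + K * n * S) := (h0.mul_left _).add (hS.mul_left _)
  have hle : ∀ r, ‖(betaMean n g r - g x) * w r‖ ≤ K * (3 / 2) * w r + K * n * (U r * w r) := by
    intro r
    rw [norm_mul, Real.norm_of_nonneg (hw0 r), Real.norm_eq_abs, ← mul_assoc, ← add_mul]
    refine mul_le_mul_of_nonneg_right ((hmean r).trans ?_) (hw0 r)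
    have := mul_le_mul_of_nonneg_left (hU r) (by positivity : 0 ≤ K * n)
    linarith
  have hsD : Summable fun r => (betaMean n g r - g x) * w r :=
    Summable.of_norm_bounded hdom.summable hle
  have hDle := tsum_of_norm_bounded hdom hle
  set D := ∑' r, (betaMean n g r - g x) * w r with hD
  have hB : HasSum (fun r => betaMean n g r * w r) (D + g x * W) := by
    have := hsD.hasSum.add (h0.mul_left (g x))
    simpa only [← add_mul, sub_add_cancel] using this
  have hT := (hasSum_betaMean_iff hν).1 hB
  have hn1 : (n : ℝ) - 1 ≠ 0 := by linarith
  refine ⟨⟨hint, hsw, (summable_mul_left_iff hn1).1 hT.summable⟩, ?_⟩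
  have hval : szaszBeta ν n g x - g x = D / W := by
    have e := hT.tsum_eq
    rw [tsum_mul_left] at e
    have : szaszBeta ν n g x =
        (((n : ℝ) - 1) * (∑' k : ℕ, szaszBetaTerm ν n g x (k + 1)) + g 0) / W := by
      unfold szaszBeta; ring
    rw [this, e]
    field_simp
    ring
  rw [hval, abs_div, abs_of_pos hW, div_div, div_le_iff₀ (by positivity)]
  refine hDle.trans ?_
  have hn0 : (n : ℝ) ≠ 0 := by linarith
  have h1 : K * n * S ≤ K * (200 * (1 + 2 * ν) ^ 2) * (1 + x ^ 2) ^ 2 * W := by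
    refine (mul_le_mul_of_nonneg_left hSle (by positivity : 0 ≤ K * n)).trans (le_of_eq ?_)
    field_simp
  -- The constant part is weakened to the growth of the moment part; with the factor `1 + x ^ 2`
  -- inside `K` this yields the cubed weight.
  have h2 : K * (3 / 2) * W * 1 ≤ K * (3 / 2) * W * (1 + x ^ 2) ^ 2 := by
    refine mul_le_mul_of_nonneg_left ?_ (by positivity)
    exact one_le_pow₀ (by nlinarith)
  calc K * (3 / 2) * W + K * n * S
      ≤ K * (3 / 2) * W * (1 + x ^ 2) ^ 2 +
        K * (200 * (1 + 2 * ν) ^ 2) * (1 + x ^ 2) ^ 2 * W := by linarith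
    _ = _ := by rw [hK]; ring

theorem theorem10 (ν : ℝ) (hν : 0 ≤ ν) :
    ∃ M : ℝ, 0 < M ∧ ∀ n : ℕ, 5 ≤ n → ∀ g : ℝ → ℝ, g ∈ CRhoStar →
      (∀ x : ℝ, 0 ≤ x → SzaszBetaDefined ν n g x) ∧
      BddAbove (Set.range fun x : Set.Ici (0 : ℝ) =>
        |szaszBeta ν n g x - g x| / (1 + (x : ℝ) ^ 2) ^ 3) ∧
      (⨆ x : Set.Ici (0 : ℝ), |szaszBeta ν n g x - g x| / (1 + (x : ℝ) ^ 2) ^ 3) ≤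
        M * (1 + 1 / (n : ℝ)) * weightedModulus g (1 / Real.sqrt n) := by
  refine ⟨3 + 400 * (1 + 2 * ν) ^ 2, by positivity, fun n hn g hg => ?_⟩
  have h := fun x : Ici (0 : ℝ) => szaszBeta_sub_bound hν hn hg x.2
  have : Nonempty (Ici (0 : ℝ)) := ⟨⟨0, self_mem_Ici⟩⟩
  refine ⟨fun x hx => (h ⟨x, hx⟩).1, ⟨_, forall_mem_range.2 fun x => (h x).2⟩, ciSup_le fun x => (h x).2⟩
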